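/- Let $\mathcal X$ be a finite nonempty set, let $k:\mathcal X\times\mathcal X\to\mathbb R$ be a positive semidefinite kernel with $k(x,x)\le 1$ for all $x\in\mathcal X$, let $\sigma>0$ and $\delta\in(0,1)$. Let $f\sim\mathcal{GP}(0,k)$, let $\{\epsilon_t\}_{t\ge1}$ be i.i.d. $\mathcal N(0,\sigma^2)$, and let $\{U_t\}_{t\ge1}$ be mutually independent random variables with $\Pr(U_t\in(0,1))=1$ and $\mathbb E[U_t]=\frac{6\delta}{|\mathcal X|\,t^2\pi^2}$ for all $t\ge1$. Put $\zeta_t=2\log(1/U_t)$. Assume that $f$, $\{\epsilon_t\}_{t\ge 1}$ and the internal randomness of the algorithm (that is, $\{U_t\}_{t\ge1}$ together with a possible random seed $W$ for breaking ties) are independent. Randomized GP-UCB with parameters $\zeta_t$ chooses, for $t=1,2,\dots$, $$x_t\in\operatorname*{arg\,max}_{x\in\mathcal X}\ \mu_{t-1}(x)+\zeta_t^{1/2}\sigma_{t-1}(x),$$ and then observes $y_t=f(x_t)+\epsilon_t$, where $$\mu_{t-1}(x)=\mathbf k_{t-1}(x)^\top(\mathbf K_{t-1}+\sigma^2\mathbf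 I)^{-1}\mathbf y_{t-1},\qquad \sigma^2_{t-1}(x)=k(x,x)-\mathbf k_{t-1}(x)^\top(\mathbf K_{t-1}+\sigma^2\mathbf I)^{-1}\mathbf k_{t-1}(x),$$ with $\mathbf k_{t-1}(x)=(k(x,x_i))_{i<t}$, $\mathbf K_{t-1}=(k(x_i,x_j))_{i,j<t}$, $\mathbf y_{t-1}=(y_i)_{i<t}$. Ties are broken in any measurable way that uses only $y_1,\dots,y_{t-1}$, $\zeta_1,\dots,\zeta_t$ and $W$. Let $R_T=\sum_{t=1}^T\bigl(\max_{x\in\mathcal X}f(x)-f(x_t)\bigr)$ and let $$\gamma_T=\max_{(a_1,\dots,a_T)\in\mathcal X^T} I\bigl((f(a_i)+\epsilon_i)_{i=1}^T;\,(f(a_i))_{i=1}^T\bigr)$$ be the maximum information gain, where $I$ is the Shannon mutual information in nats and repetitions among the $a_i$ are allowed. Put $C_1=2/\log(1+\sigma^{-2})$. Then $$\Pr\left(\forall\,T\ge1:\ R_T\le 2\sqrt{C_1\gamma_T\sum_{t=1}^T\zeta_t}\right)\ge 1-\delta .$$ -/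

import Mathlib

open MeasureTheory ProbabilityTheory

noncomputable section

namespace GPUCB

/-- The Shannon mutual information `I(Y ; Z)` (in nats) of two random variables: the
Kullback-Leibler divergence of their joint law from the product of their marginal laws. -/
def mutualInfo {Ω α β : Type*} [MeasurableSpace Ω] [MeasurableSpace α] [MeasurableSpace β]
    (Y : Ω → α) (Z : Ω → β) (P : Measure Ω) : ENNReal :=
  InformationTheory.klDiv (P.map (fun ω => (Y ω, Z ω))) ((P.map Y).prod (P.map Z))

/-- The kernel matrix `(k (a i) (a j))` of the points `a 0, …, a (n - 1)`. -/
def gram {X : Type*} (k : X → X → ℝ) {n : ℕ} (a : Fin n → X) : Matrix (Fin n) (Fin n) ℝ :=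
  Matrix.of fun i j => k (a i) (a j)

/-- The joint law of `f_A = (f (a i))_i`, where `f` is a centred Gaussian process with
covariance `k`, and of independent noises `ε_A = (ε_i)_i`, i.i.d. with law `N(0, σ²)`. -/
def signalNoiseLaw {X : Type*} (k : X → X → ℝ) (σ : ℝ) {n : ℕ} (a : Fin n → X) :
    Measure (EuclideanSpace ℝ (Fin n) × (Fin n → ℝ)) :=
  (multivariateGaussian 0 (gram k a)).prod
    (Measure.pi fun _ => gaussianReal 0 (Real.toNNReal (σ ^ 2)))

/-- The information gain `I(y_A ; f_A)` with `y_A = f_A + ε_A`. -/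
def infoGain {X : Type*} (k : X → X → ℝ) (σ : ℝ) {n : ℕ} (a : Fin n → X) : ENNReal :=
  mutualInfo (fun p : EuclideanSpace ℝ (Fin n) × (Fin n → ℝ) => fun i => p.1 i + p.2 i)
    (fun p => p.1) (signalNoiseLaw k σ a)

/-- The maximum information gain `γ_n`: the largest information gain of `n` queried points,
repetitions allowed. (Each information gain is finite when `0 < σ`, and there are
finitely many of them when `X` is finite.) -/
def maxInfoGain {X : Type*} (k : X → X → ℝ) (σ : ℝ) (n : ℕ) : ℝ :=
  (⨆ a : Fin n → X, infoGain k σ a).toReal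

/-- Posterior mean at `z` given the data `(a i, y i)`, `i < n`:
`k_n(z)ᵀ (K + σ² I)⁻¹ y`. -/
def postMean {X : Type*} (k : X → X → ℝ) (σ : ℝ) {n : ℕ} (a : Fin n → X) (y : Fin n → ℝ)
    (z : X) : ℝ :=
  (fun i => k z (a i)) ⬝ᵥ
    (Matrix.mulVec (gram k a + σ ^ 2 • (1 : Matrix (Fin n) (Fin n) ℝ))⁻¹ y)

/-- Posterior variance at `z` given observations at the points `a i`, `i < n`:
`k(z, z) - k_n(z)ᵀ (K + σ² I)⁻¹ k_n(z)`. -/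
def postVar {X : Type*} (k : X → X → ℝ) (σ : ℝ) {n : ℕ} (a : Fin n → X) (z : X) : ℝ :=
  k z z - (fun i => k z (a i)) ⬝ᵥ
    (Matrix.mulVec (gram k a + σ ^ 2 • (1 : Matrix (Fin n) (Fin n) ℝ))⁻¹ fun i => k z (a i))

/-- The upper confidence bound `μ(z) + ζ^{1/2} σ(z)` built from the data `(a i, y i)`, `i < n`. -/
def ucb {X : Type*} (k : X → X → ℝ) (σ : ℝ) {n : ℕ} (a : Fin n → X) (y : Fin n → ℝ) (ζ : ℝ)
    (z : X) : ℝ :=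
  postMean k σ a y z + √ζ * √(postVar k σ a z)

/-- The observation `y = f(x_t) + ε_t` of the round with (zero-based) index `t`. -/
def obs {Ω X : Type*} (f : X → Ω → ℝ) (ε : ℕ → Ω → ℝ) (x : ℕ → Ω → X) (t : ℕ) (ω : Ω) : ℝ :=
  f (x t ω) ω + ε t ω

/-- The information available when the input of round `t` is chosen: the observations of the
earlier rounds, the confidence parameters up to and including round `t`, and a seed `W` used to
break ties. (The earlier inputs are functions of this information, by recursion.) -/
abbrev history {Ω X S : Type*} [MeasurableSpace S] (f : X → Ω → ℝ) (ε ζ : ℕ → Ω → ℝ) (W : Ω → S)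
    (x : ℕ → Ω → X) (t : ℕ) : MeasurableSpace Ω :=
  (⨆ s : Fin t, MeasurableSpace.comap (obs f ε x s) inferInstance) ⊔
    (⨆ s : Fin (t + 1), MeasurableSpace.comap (ζ s) inferInstance) ⊔
    MeasurableSpace.comap W inferInstance

/-- `x` is a run of randomized GP-UCB with confidence parameters `ζ` on a finite domain
`X`: the input of every round is chosen from the available information only, and it
maximizes the upper confidence bound of the data collected in the earlier rounds.
Rounds are indexed from `0`, so that index `t` is round `t + 1`. -/
structure IsRandomizedGPUCB {Ω X S : Type*} [MeasurableSpace Ω] [MeasurableSpace S]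
    (P : Measure Ω) (k : X → X → ℝ) (σ : ℝ) (f : X → Ω → ℝ) (ε ζ : ℕ → Ω → ℝ) (W : Ω → S)
    (x : ℕ → Ω → X) : Prop where
  nonanticipating : ∀ t z, MeasurableSet[history f ε ζ W x t] {ω | x t ω = z}
  maximizes : ∀ᵐ ω ∂P, ∀ t z,
    ucb k σ (fun s : Fin t => x s ω) (fun s : Fin t => obs f ε x s ω) (ζ t ω) z ≤
      ucb k σ (fun s : Fin t => x s ω) (fun s : Fin t => obs f ε x s ω) (ζ t ω) (x t ω)

/-- The cumulative regret `R_T`, the sum of `max f - f(x_t)` over the first `T` rounds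
(`X` is finite and nonempty where this is used, so that the supremum is a maximum). -/
def cumRegret {Ω X : Type*} (f : X → Ω → ℝ) (x : ℕ → Ω → X) (T : ℕ) (ω : Ω) : ℝ :=
  ∑ t ∈ Finset.range T, ((⨆ z, f z ω) - f (x t ω) ω)

/-- `f` is a (measurable) centred Gaussian process with covariance function `k`. -/
structure IsCentredGP {Ω X : Type*} [MeasurableSpace Ω] (P : Measure Ω) (k : X → X → ℝ)
    (f : X → Ω → ℝ) : Prop where
  measurable : ∀ z, Measurable (f z)
  gaussian : IsGaussianProcess f P
  mean_zero : ∀ z, ∫ ω, f z ω ∂P = 0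
  covariance : ∀ z z', cov[f z, f z'; P] = k z z'

end GPUCB

end

open MeasureTheory ProbabilityTheory

noncomputable section

namespace GPUCB

/-! The difficulty is that the inputs are adaptive. For a deterministic path `a`, the error of the
posterior mean is Gaussian with the posterior variance and independent of the observations along `a`
(`posterior_residual`), hence also of those observations together with the algorithm's randomness.
The event that the algorithm follows `a` is determined by exactly this data (`measurableSet_path`).
On it the Gaussian tail bound with threshold `√ζ_t` fails with conditional probability at most `exp
(-ζ_t / 2) = U_t`. Path events are disjoint, so summing over paths costs nothing and leaves `E[U_t]`
(`measure_confidence_fail_le`). A union bound over points and rounds then gives `δ` by the Basel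
sum.

Where all confidence intervals hold, optimism bounds each instantaneous regret by `2 √ζ_t
σ_{t-1}(x_t)`, and Cauchy-Schwarz separates the parameters from the variances. Concavity of `log`
compares each variance with `log (1 + σ⁻² σ²_{t-1}(x_t))`. By Schur complements these logarithms sum
to a log-determinant, which is twice the information gain of the path (`infoGain_eq`) and so at most
`2 γ_T`. This part is deterministic, path by path. -/

open Matrix
open scoped MatrixOrder Matrix.Norms.L2Operator

/-! ### Densities of Gaussian laws on `ℝⁿ` -/

/-- A finite product of measures with integrable nonnegative densities has the product density. -/
lemma pi_withDensity_ofReal {ι : Type*} [Fintype ι] {μ ν : ι → Measure ℝ} [∀ i, SigmaFinite (μ i)]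
    [∀ i, SigmaFinite (ν i)] {g : ι → ℝ → ℝ} (hg : ∀ i, Integrable (g i) (μ i))
    (hg0 : ∀ i x, 0 ≤ g i x) (hν : ∀ i, ν i = (μ i).withDensity fun x => ENNReal.ofReal (g i x)) :
    Measure.pi ν = (Measure.pi μ).withDensity fun x => ENNReal.ofReal (∏ i, g i (x i)) := by
  refine (Measure.pi_eq fun s hs => ?_)
  rw [withDensity_apply _ (MeasurableSet.univ_pi hs), Measure.restrict_pi_pi,
    ← ofReal_integral_eq_lintegral_ofReal]
  · rw [integral_fintype_prod_eq_prod, ENNReal.ofReal_prod_of_nonneg]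
    · refine Finset.prod_congr rfl fun i _ => ?_
      rw [hν, withDensity_apply _ (hs i), ofReal_integral_eq_lintegral_ofReal (hg i).restrict]
      exact Filter.Eventually.of_forall (hg0 i)
    · exact fun i _ => integral_nonneg (hg0 i)
  · exact Integrable.fintype_prod_dep fun i => (hg i).restrict
  · exact Filter.Eventually.of_forall fun x => Finset.prod_nonneg fun i _ => hg0 i _

/-- The density of the centred Gaussian law with invertible covariance matrix `M`. -/
def gaussianDensity {n : ℕ} (M : Matrix (Fin n) (Fin n) ℝ) (y : Fin n → ℝ) : ℝ :=
  (√(2 * Real.pi))⁻¹ ^ n * (√M.det)⁻¹ * Real.exp (-(y ⬝ᵥ M⁻¹ *ᵥ y) / 2)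

lemma gaussianDensity_pos {n : ℕ} {M : Matrix (Fin n) (Fin n) ℝ} (hM : 0 < M.det)
    (y : Fin n → ℝ) : 0 < gaussianDensity M y := by
  unfold gaussianDensity; positivity

lemma measurable_gaussianDensity {n : ℕ} (M : Matrix (Fin n) (Fin n) ℝ) :
    Measurable (gaussianDensity M) := by
  unfold gaussianDensity
  have : Continuous fun y : Fin n → ℝ => y ⬝ᵥ M⁻¹ *ᵥ y := by fun_prop
  fun_prop

lemma log_gaussianDensity {n : ℕ} {M : Matrix (Fin n) (Fin n) ℝ} (hM : 0 < M.det)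
    (y : Fin n → ℝ) : Real.log (gaussianDensity M y) =
      -n * Real.log √(2 * Real.pi) - Real.log M.det / 2 - (y ⬝ᵥ M⁻¹ *ᵥ y) / 2 := by
  have h1 : (√(2 * Real.pi))⁻¹ ^ n ≠ 0 := by positivity
  have h2 : (√M.det)⁻¹ ≠ 0 := by positivity
  rw [gaussianDensity, Real.log_mul (mul_ne_zero h1 h2) (Real.exp_ne_zero _), Real.log_mul h1 h2,
    Real.log_exp, Real.log_pow, Real.log_inv, Real.log_inv, Real.log_sqrt (x := M.det) hM.le]
  ring

lemma pi_stdGaussian_eq_withDensity (n : ℕ) :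
    Measure.pi (fun _ : Fin n => gaussianReal 0 1) =
      volume.withDensity fun x => ENNReal.ofReal (gaussianDensity (1 : Matrix (Fin n) (Fin n) ℝ) x) := by
  rw [pi_withDensity_ofReal (μ := fun _ => volume) (g := fun _ => gaussianPDFReal 0 1)
    (fun _ => integrable_gaussianPDFReal 0 1) (fun _ => gaussianPDFReal_nonneg 0 1)
    (fun _ => by rw [gaussianReal_of_var_ne_zero 0 one_ne_zero]; rfl)]
  congr with x
  simp only [gaussianDensity, gaussianPDFReal, Finset.prod_mul_distrib, ← Real.exp_sum]
  simp [dotProduct, Finset.sum_div, ← sq, Finset.sum_neg_distrib, neg_div]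

lemma map_mulVec_withDensity {n : ℕ} {A : Matrix (Fin n) (Fin n) ℝ} (hA : A.det ≠ 0)
    {g : (Fin n → ℝ) → ENNReal} (hg : Measurable g) :
    (volume.withDensity fun x => g (A *ᵥ x)).map (fun x => A *ᵥ x) =
      volume.withDensity fun y => ENNReal.ofReal |A.det⁻¹| * g y := by
  have hmeas : Measurable fun x : Fin n → ℝ => A *ᵥ x := by
    have : Continuous fun x : Fin n → ℝ => A *ᵥ x := by fun_prop
    exact this.measurable
  have hvol : (volume : Measure (Fin n → ℝ)).map (fun x => A *ᵥ x) =
      ENNReal.ofReal |A.det⁻¹| • volume :=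
    Real.map_matrix_volume_pi_eq_smul_volume_pi hA
  ext s hs
  rw [Measure.map_apply hmeas hs, withDensity_apply _ (hmeas hs), withDensity_apply _ hs,
    ← setLIntegral_map hs hg hmeas, hvol, Measure.restrict_smul, lintegral_smul_measure,
    lintegral_const_mul _ hg, smul_eq_mul]

lemma map_mulVec_pi_stdGaussian {n : ℕ} {A : Matrix (Fin n) (Fin n) ℝ} (hA : A.det ≠ 0) :
    (Measure.pi (fun _ : Fin n => gaussianReal 0 1)).map (fun x => A *ᵥ x) =
      volume.withDensity fun y => ENNReal.ofReal (gaussianDensity (A * Aᵀ) y) := by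
  have hu : IsUnit A.det := hA.isUnit
  have hquad (x : Fin n → ℝ) : (A *ᵥ x) ⬝ᵥ (A * Aᵀ)⁻¹ *ᵥ (A *ᵥ x) = x ⬝ᵥ x := by
    rw [mulVec_mulVec, Matrix.mul_inv_rev, Matrix.mul_assoc, nonsing_inv_mul _ hu, Matrix.mul_one,
      dotProduct_mulVec, vecMul_mulVec, ← transpose_nonsing_inv, ← transpose_mul,
      nonsing_inv_mul _ hu]
    simp
  have hdet : √(A * Aᵀ).det = |A.det| := by
    rw [det_mul, det_transpose, Real.sqrt_mul_self_eq_abs]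
  have h1 : (fun x => ENNReal.ofReal (gaussianDensity (1 : Matrix (Fin n) (Fin n) ℝ) x)) =
      fun x => ENNReal.ofReal (|A.det| * gaussianDensity (A * Aᵀ) (A *ᵥ x)) := by
    ext x
    have : |A.det| ≠ 0 := abs_ne_zero.2 hA
    simp only [gaussianDensity, hquad, hdet]
    congr 1
    field_simp
    simp
  rw [pi_stdGaussian_eq_withDensity, h1, map_mulVec_withDensity hA
    (g := fun y => ENNReal.ofReal (|A.det| * gaussianDensity (A * Aᵀ) y))
    (by have := measurable_gaussianDensity (A * Aᵀ); fun_prop)]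
  congr with y
  rw [← ENNReal.ofReal_mul (abs_nonneg _), ← mul_assoc, ← abs_mul, inv_mul_cancel₀ hA, abs_one,
    one_mul]

/-- The characteristic function of a Gaussian law involves only the mean and variance of each linear
functional, and these are polynomials in the coordinate means and covariances. -/
lemma isGaussian_ext_pi {n : ℕ} {μ ν : Measure (Fin n → ℝ)} [IsGaussian μ] [IsGaussian ν]
    (hm : ∀ i, ∫ y, y i ∂μ = ∫ y, y i ∂ν)
    (hc : ∀ i j, cov[fun y => y i, fun y => y j; μ] = cov[fun y => y i, fun y => y j; ν]) :
    μ = ν := by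
  have hL2 (ρ : Measure (Fin n → ℝ)) [IsGaussian ρ] (i : Fin n) : MemLp (fun y => y i) 2 ρ :=
    (IsGaussian.hasGaussianLaw_id (μ := ρ)).eval (E := fun _ : Fin n => ℝ) (X := fun i (y : Fin n → ℝ) => y i) i |>.memLp_two
  have hint (ρ : Measure (Fin n → ℝ)) [IsGaussian ρ] (i : Fin n) : Integrable (fun y => y i) ρ :=
    (hL2 ρ i).integrable (by norm_num)
  apply Measure.ext_of_charFunDual
  ext L
  obtain ⟨c, hrepr⟩ : ∃ c : Fin n → ℝ, ⇑L = fun y => ∑ i, c i * y i := by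
    refine ⟨fun i => L (Pi.single i 1), funext fun y => ?_⟩
    conv_lhs => rw [← Finset.univ_sum_single y, map_sum]
    refine Finset.sum_congr rfl fun i _ => ?_
    rw [mul_comm, ← smul_eq_mul, ← map_smul, ← Pi.single_smul', smul_eq_mul, mul_one]
  have hmean (ρ : Measure (Fin n → ℝ)) [IsGaussian ρ] :
      ρ[L] = ∑ i, c i * ∫ y, y i ∂ρ := by
    rw [hrepr, integral_finsetSum _ fun i _ => (hint ρ i).const_mul _]
    simp_rw [integral_const_mul]
  have hvar (ρ : Measure (Fin n → ℝ)) [IsGaussian ρ] : Var[L; ρ] =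
      ∑ i, ∑ j, c i * (c j *
        cov[fun y => y i, fun y => y j; ρ]) := by
    rw [← covariance_self (by fun_prop), hrepr, covariance_fun_sum_fun_sum
      (fun i => (hL2 ρ i).const_mul _) (fun i => (hL2 ρ i).const_mul _)]
    simp_rw [covariance_const_mul_left, covariance_const_mul_right]
  rw [IsGaussian.charFunDual_eq, IsGaussian.charFunDual_eq, hvar, hvar, integral_complex_ofReal,
    integral_complex_ofReal, hmean, hmean]
  simp_rw [hm, hc]

lemma exists_mul_transpose_of_posDef {n : ℕ} {M : Matrix (Fin n) (Fin n) ℝ} (hM : M.PosDef) :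
    ∃ A : Matrix (Fin n) (Fin n) ℝ, A.det ≠ 0 ∧ M = A * Aᵀ := by
  obtain ⟨B, hB⟩ := CStarAlgebra.nonneg_iff_eq_star_mul_self.mp hM.posSemidef.nonneg
  refine ⟨Bᵀ, fun h => hM.det_pos.ne' ?_, by simpa [star_eq_conjTranspose] using hB⟩
  rw [hB, det_mul, ← det_transpose B, h, mul_zero]

/-- A centred Gaussian law with positive definite covariance matrix has the Gaussian density. -/
lemma eq_withDensity_gaussianDensity {n : ℕ} {M : Matrix (Fin n) (Fin n) ℝ} (hM : M.PosDef)
    {μ : Measure (Fin n → ℝ)} [IsGaussian μ] (hm : ∀ i, ∫ y, y i ∂μ = 0)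
    (hc : ∀ i j, cov[fun y => y i, fun y => y j; μ] = M i j) :
    μ = volume.withDensity fun y => ENNReal.ofReal (gaussianDensity M y) := by
  obtain ⟨A, hA, rfl⟩ := exists_mul_transpose_of_posDef hM
  -- The target density is now the law of `A *ᵥ x` for standard Gaussian `x`, so comparing first and
  -- second moments suffices.
  rw [← map_mulVec_pi_stdGaussian hA]
  set γ := Measure.pi (fun _ : Fin n => gaussianReal 0 1) with hγ
  let L : (Fin n → ℝ) →L[ℝ] (Fin n → ℝ) := (toLin' A).toContinuousLinearMap
  have hLA : (fun x => A *ᵥ x) = ⇑L := rfl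
  have hLm : Measurable L := by fun_prop
  have hind : iIndepFun (fun (i : Fin n) (x : Fin n → ℝ) => x i) γ :=
    iIndepFun_pi (X := fun _ => id) (by fun_prop)
  have hlaw (i : Fin n) : HasLaw (fun x : Fin n → ℝ => x i) (gaussianReal 0 1) γ :=
    ⟨(measurable_pi_apply i).aemeasurable, (measurePreserving_eval _ i).map_eq⟩
  have hL2 (i : Fin n) : MemLp (fun x : Fin n → ℝ => x i) 2 γ :=
    (hlaw i).hasGaussianLaw.memLp_two
  have : IsGaussian γ := by
    have := (hind.hasGaussianLaw fun i => (hlaw i).hasGaussianLaw).isGaussian_map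
    simpa using this
  have hmean (i : Fin n) : ∫ x, x i ∂γ = 0 := by
    rw [(hlaw i).integral_eq, integral_id_gaussianReal]
  have hcov (i j : Fin n) : cov[fun x => x i, fun x => x j; γ] = (1 : Matrix _ _ ℝ) i j := by
    by_cases h : i = j
    · subst h
      rw [covariance_self (hlaw i).aemeasurable, (hlaw i).variance_eq, variance_id_gaussianReal]
      simp
    · rw [(hind.indepFun h).covariance_eq_zero (hL2 i) (hL2 j)]
      simp [h]
  rw [hLA]
  refine isGaussian_ext_pi (fun i => ?_) fun i j => ?_
  · rw [hm, integral_map hLm.aemeasurable (measurable_pi_apply i).aestronglyMeasurable, ← hLA]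
    simp only [mulVec, dotProduct]
    rw [integral_finsetSum _ fun k _ => ((hL2 k).integrable (by norm_num)).const_mul _]
    simp [integral_const_mul, hmean]
  · rw [hc, covariance_map_fun (measurable_pi_apply i).aestronglyMeasurable
      (measurable_pi_apply j).aestronglyMeasurable hLm.aemeasurable, ← hLA]
    simp only [mulVec, dotProduct]
    rw [covariance_fun_sum_fun_sum (fun k => (hL2 k).const_mul _) (fun k => (hL2 k).const_mul _)]
    simp_rw [covariance_const_mul_left, covariance_const_mul_right, hcov]
    simp [mul_apply, one_apply]

/-! ### Information gain as a log-determinant -/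

section InfoGain

lemma klDiv_withDensity_ofReal {α : Type*} [MeasurableSpace α] {m μ ν : Measure α}
    [IsProbabilityMeasure μ] [IsProbabilityMeasure ν] {p q : α → ℝ} (hp : Measurable p)
    (hq : Measurable q) (hp0 : ∀ x, 0 < p x) (hq0 : ∀ x, 0 < q x)
    (hμ : μ = m.withDensity fun x => ENNReal.ofReal (p x))
    (hν : ν = m.withDensity fun x => ENNReal.ofReal (q x))
    (hint : Integrable (fun x => Real.log (p x) - Real.log (q x)) μ) :
    InformationTheory.klDiv μ ν =
      ENNReal.ofReal (∫ x, (Real.log (p x) - Real.log (q x)) ∂μ) := by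
  have hμν : μ = ν.withDensity fun x => ENNReal.ofReal (p x / q x) := by
    rw [hν, hμ, ← withDensity_mul _ (by fun_prop) (by fun_prop)]
    congr with x
    rw [Pi.mul_apply, ← ENNReal.ofReal_mul (hq0 x).le, mul_div_cancel₀ _ (hq0 x).ne']
  have hac : μ ≪ ν := hμν ▸ withDensity_absolutelyContinuous _ _
  have hllr : llr μ ν =ᵐ[μ] fun x => Real.log (p x) - Real.log (q x) := by
    have h := Measure.rnDeriv_withDensity ν (f := fun x => ENNReal.ofReal (p x / q x)) (by fun_prop)
    rw [← hμν] at h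
    filter_upwards [hac.ae_le h] with x hx
    rw [llr, hx, ENNReal.toReal_ofReal (div_pos (hp0 x) (hq0 x)).le,
      Real.log_div (hp0 x).ne' (hq0 x).ne']
  rw [InformationTheory.klDiv_of_ac_of_integrable hac ((integrable_congr hllr).2 hint),
    integral_congr_ae hllr]
  -- Both total masses are one, so the mass correction in `klDiv` vanishes.
  simp

variable {Ω : Type*} [MeasurableSpace Ω] {P : Measure Ω} {n : ℕ}

lemma covariance_noise [IsProbabilityMeasure P] {e : Fin n → Ω → ℝ} {s : ℝ}
    (he : ∀ i, MemLp (e i) 2 P) (hee : iIndepFun e P) (hvar : ∀ i, Var[e i; P] = s)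
    (i j : Fin n) : cov[e i, e j; P] = (s • (1 : Matrix (Fin n) (Fin n) ℝ)) i j := by
  by_cases h : i = j
  · subst h
    rw [covariance_self (he i).aemeasurable, hvar]
    simp
  · rw [(hee.indepFun h).covariance_eq_zero (he i) (he j)]
    simp [h]

lemma covariance_signal_add_noise [IsProbabilityMeasure P] {F e : Fin n → Ω → ℝ} {s : ℝ}
    (hF : ∀ i, MemLp (F i) 2 P) (he : ∀ i, MemLp (e i) 2 P) (hFe : ∀ i j, IndepFun (F i) (e j) P)
    (hee : iIndepFun e P) (hvar : ∀ i, Var[e i; P] = s) (i j : Fin n) :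
    cov[fun ω => F i ω + e i ω, fun ω => F j ω + e j ω; P] =
      cov[F i, F j; P] + (s • (1 : Matrix (Fin n) (Fin n) ℝ)) i j := by
  change cov[F i + e i, F j + e j; P] = _
  rw [covariance_add_left (hF i) (he i) ((hF j).add (he j)),
    covariance_add_right (hF i) (hF j) (he j), covariance_add_right (he i) (hF j) (he j),
    (hFe i j).covariance_eq_zero (hF i) (he j), covariance_comm (e i) (F j),
    (hFe j i).covariance_eq_zero (hF j) (he i), covariance_noise he hee hvar]
  ring

/-- The expectation is `trace (M⁻¹ * M)`; only second moments matter, not Gaussianity. -/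
lemma integral_quadForm_inv [IsProbabilityMeasure P] {Y : Fin n → Ω → ℝ}
    {M : Matrix (Fin n) (Fin n) ℝ} (hM : IsUnit M.det) (hY : ∀ i, MemLp (Y i) 2 P)
    (hmean : ∀ i, P[Y i] = 0) (hcov : ∀ i j, cov[Y i, Y j; P] = M i j) :
    Integrable (fun ω => (fun i => Y i ω) ⬝ᵥ M⁻¹ *ᵥ fun i => Y i ω) P ∧
      ∫ ω, (fun i => Y i ω) ⬝ᵥ M⁻¹ *ᵥ (fun i => Y i ω) ∂P = n := by
  have hprod (i j : Fin n) : ∫ ω, Y i ω * Y j ω ∂P = M i j := by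
    rw [← hcov, covariance_eq_sub (hY i) (hY j), hmean, hmean]
    simp
  have hint (i j : Fin n) : Integrable (fun ω => Y i ω * Y j ω) P := (hY i).integrable_mul (hY j)
  have hexp (ω : Ω) : (fun i => Y i ω) ⬝ᵥ M⁻¹ *ᵥ (fun i => Y i ω) =
      ∑ i, ∑ j, M⁻¹ i j * (Y i ω * Y j ω) := by
    simp only [dotProduct, mulVec, Finset.mul_sum]
    exact Finset.sum_congr rfl fun i _ => Finset.sum_congr rfl fun j _ => by ring
  have hsymm (i j : Fin n) : M i j = M j i := by rw [← hcov, covariance_comm, hcov]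
  simp_rw [hexp]
  refine ⟨integrable_finsetSum _ fun i _ => integrable_finsetSum _ fun j _ =>
    (hint i j).const_mul _, ?_⟩
  rw [integral_finsetSum Finset.univ (f := fun i ω => ∑ j, M⁻¹ i j * (Y i ω * Y j ω))
    fun i _ => integrable_finsetSum _ fun j _ => (hint i j).const_mul _]
  have hrow (i : Fin n) : ∫ ω, ∑ j, M⁻¹ i j * (Y i ω * Y j ω) ∂P = ∑ j, M⁻¹ i j * M i j := by
    rw [integral_finsetSum _ fun j _ => (hint i j).const_mul _]
    simp_rw [integral_const_mul, hprod]
  simp_rw [hrow]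
  calc ∑ i, ∑ j, M⁻¹ i j * M i j = (M⁻¹ * M).trace := by
        simp only [trace, diag, mul_apply]
        exact Finset.sum_congr rfl fun i _ => Finset.sum_congr rfl fun j _ => by rw [hsymm i j]
    _ = n := by rw [nonsing_inv_mul _ hM]; simp

lemma integral_log_gaussianDensity [IsProbabilityMeasure P] {Y : Fin n → Ω → ℝ}
    {M : Matrix (Fin n) (Fin n) ℝ} (hM : 0 < M.det) (hY : ∀ i, MemLp (Y i) 2 P)
    (hmean : ∀ i, P[Y i] = 0) (hcov : ∀ i j, cov[Y i, Y j; P] = M i j) :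
    Integrable (fun ω => Real.log (gaussianDensity M fun i => Y i ω)) P ∧
      ∫ ω, Real.log (gaussianDensity M fun i => Y i ω) ∂P =
        -n * Real.log √(2 * Real.pi) - Real.log M.det / 2 - n / 2 := by
  obtain ⟨hint, hval⟩ := integral_quadForm_inv hM.ne'.isUnit hY hmean hcov
  simp_rw [log_gaussianDensity hM]
  refine ⟨(integrable_const _).sub (hint.div_const 2), ?_⟩
  rw [integral_sub (integrable_const _) (hint.div_const 2), integral_div, hval]
  simp

/-- Translation invariance of Lebesgue measure in each fibre. Keeping `G` as a factor of the
reference measure allows a signal law without Lebesgue density, as happens when the kernel matrix is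
singular (for instance with repeated inputs). -/
lemma map_add_prod_eq_withDensity {E : Type*} [MeasurableSpace E] {G : Measure E} [SFinite G]
    {c : E → Fin n → ℝ} (hc : Measurable c) {g : (Fin n → ℝ) → ENNReal} (hg : Measurable g)
    [SFinite ((volume : Measure (Fin n → ℝ)).withDensity g)] :
    (G.prod (volume.withDensity g)).map (fun p => (c p.1 + p.2, p.1)) =
      ((volume : Measure (Fin n → ℝ)).prod G).withDensity fun p => g (p.1 - c p.2) := by
  ext s hs
  have hmeas : Measurable fun p : E × (Fin n → ℝ) => (c p.1 + p.2, p.1) := by fun_prop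
  have hg' : Measurable fun p : (Fin n → ℝ) × E => s.indicator (fun p => g (p.1 - c p.2)) p :=
    Measurable.indicator (by fun_prop) hs
  rw [Measure.map_apply hmeas hs, Measure.prod_apply (hmeas hs), withDensity_apply _ hs,
    ← lintegral_indicator hs, lintegral_prod_symm' _ hg']
  refine lintegral_congr fun f => ?_
  have hsec : MeasurableSet (Prod.mk f ⁻¹' ((fun p : E × (Fin n → ℝ) => (c p.1 + p.2, p.1)) ⁻¹' s)) :=
    (hmeas.comp measurable_prodMk_left) hs
  rw [withDensity_apply _ hsec, ← lintegral_indicator hsec,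
    ← lintegral_add_left_eq_self (fun y => s.indicator (fun p => g (p.1 - c p.2)) (y, f)) (c f)]
  refine lintegral_congr fun y => ?_
  simp [Set.indicator, Set.mem_preimage]
  rfl

lemma gram_posSemidef {X : Type*} {k : X → X → ℝ} (hk : (Matrix.of k).PosSemidef)
    (a : Fin n → X) : (gram k a).PosSemidef := hk.submatrix a

lemma gram_add_posDef {X : Type*} {k : X → X → ℝ} (hk : (Matrix.of k).PosSemidef) {σ : ℝ}
    (hσ : 0 < σ) (a : Fin n → X) :
    (gram k a + σ ^ 2 • (1 : Matrix (Fin n) (Fin n) ℝ)).PosDef :=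
  (PosDef.one.smul (by positivity)).posSemidef_add (gram_posSemidef hk a)

/-- The information gain of a Gaussian signal observed with Gaussian noise. -/
lemma infoGain_eq {X : Type*} {k : X → X → ℝ} (hk : (Matrix.of k).PosSemidef) {σ : ℝ}
    (hσ : 0 < σ) (a : Fin n → X) :
    infoGain k σ a = ENNReal.ofReal
      ((Real.log (gram k a + σ ^ 2 • (1 : Matrix (Fin n) (Fin n) ℝ)).det
        - n * Real.log (σ ^ 2)) / 2) := by
  set G := multivariateGaussian (0 : EuclideanSpace ℝ (Fin n)) (gram k a) with hG
  set N := Measure.pi (fun _ : Fin n => gaussianReal 0 (Real.toNNReal (σ ^ 2))) with hN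
  set M := gram k a + σ ^ 2 • (1 : Matrix (Fin n) (Fin n) ℝ) with hM
  set S := σ ^ 2 • (1 : Matrix (Fin n) (Fin n) ℝ) with hS
  have hMpos : M.PosDef := gram_add_posDef hk hσ a
  have hSpos : S.PosDef := PosDef.one.smul (by positivity)
  set F : Fin n → EuclideanSpace ℝ (Fin n) × (Fin n → ℝ) → ℝ := fun i p => p.1 i with hF
  set e : Fin n → EuclideanSpace ℝ (Fin n) × (Fin n → ℝ) → ℝ := fun i p => p.2 i with he
  set Y : Fin n → EuclideanSpace ℝ (Fin n) × (Fin n → ℝ) → ℝ := fun i p => F i p + e i p with hY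
  set Q := G.prod N with hQ
  have hsnd : HasLaw Prod.snd N Q := ⟨measurable_snd.aemeasurable, by simp [hQ]⟩
  have hfst : HasLaw Prod.fst G Q := ⟨measurable_fst.aemeasurable, by simp [hQ]⟩
  have hFe : IndepFun Prod.fst Prod.snd Q := indepFun_prod measurable_id measurable_id
  have hlawN (i : Fin n) : HasLaw (fun x : Fin n → ℝ => x i)
      (gaussianReal 0 (Real.toNNReal (σ ^ 2))) N :=
    ⟨(measurable_pi_apply i).aemeasurable, (measurePreserving_eval _ i).map_eq⟩
  have hlawe (i : Fin n) : HasLaw (e i) (gaussianReal 0 (Real.toNNReal (σ ^ 2))) Q :=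
    (hlawN i).comp hsnd
  have hlawF (i : Fin n) : HasLaw (F i) (gaussianReal 0 (gram k a i i).toNNReal) Q := by
    have := measurePreserving_eval_multivariateGaussian (μ := 0) (gram_posSemidef hk a) (i := i)
    exact HasLaw.comp ⟨this.measurable.aemeasurable, by simpa using this.map_eq⟩ hfst
  have hvare (i : Fin n) : Var[e i; Q] = σ ^ 2 := by
    rw [(hlawe i).variance_eq, variance_id_gaussianReal, Real.coe_toNNReal _ (by positivity)]
  have hF2 (i : Fin n) : MemLp (F i) 2 Q := (hlawF i).hasGaussianLaw.memLp_two
  have he2 (i : Fin n) : MemLp (e i) 2 Q := (hlawe i).hasGaussianLaw.memLp_two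
  have hY2 (i : Fin n) : MemLp (Y i) 2 Q := (hF2 i).add (he2 i)
  have hee : iIndepFun e Q := (iIndepFun_iff_hasLaw_pi_pi hlawe).2 hsnd
  have hmeanF (i : Fin n) : Q[F i] = 0 := by rw [(hlawF i).integral_eq, integral_id_gaussianReal]
  have hmeane (i : Fin n) : Q[e i] = 0 := by rw [(hlawe i).integral_eq, integral_id_gaussianReal]
  have hmeanY (i : Fin n) : Q[Y i] = 0 := by
    simp only [hY]
    rw [integral_add ((hF2 i).integrable (by norm_num)) ((he2 i).integrable (by norm_num)), hmeanF,
      hmeane, add_zero]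
  have hcovF (i j : Fin n) : cov[F i, F j; Q] = gram k a i j := by
    rw [← covariance_eval_multivariateGaussian (μ := 0) (gram_posSemidef hk a) i j, ← hG,
      ← hfst.map_eq, covariance_map_fun (by fun_prop) (by fun_prop) (by fun_prop)]
  have hcovY (i j : Fin n) : cov[Y i, Y j; Q] = M i j := by
    rw [covariance_signal_add_noise hF2 he2 (fun i j => hFe.comp
      (φ := fun x : EuclideanSpace ℝ (Fin n) => x i) (ψ := fun x : Fin n → ℝ => x j)
      (by fun_prop) (measurable_pi_apply j)) hee hvare, hcovF]
    rfl
  have hcove (i j : Fin n) : cov[e i, e j; Q] = S i j := covariance_noise he2 hee hvare i j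
  have hGe : HasGaussianLaw (fun p i => e i p) Q :=
    hee.hasGaussianLaw fun i => (hlawe i).hasGaussianLaw
  let L : EuclideanSpace ℝ (Fin n) × (Fin n → ℝ) →L[ℝ] (Fin n → ℝ) :=
    (EuclideanSpace.equiv (Fin n) ℝ).toContinuousLinearMap ∘L ContinuousLinearMap.fst ℝ _ _ +
      ContinuousLinearMap.snd ℝ _ _
  have hGY : HasGaussianLaw (fun p i => Y i p) Q :=
    (hFe.hasGaussianLaw hfst.hasGaussianLaw hGe).map L
  have hlaw {Z : Fin n → EuclideanSpace ℝ (Fin n) × (Fin n → ℝ) → ℝ}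
      {V : Matrix (Fin n) (Fin n) ℝ} (hV : V.PosDef) (hZ : HasGaussianLaw (fun p i => Z i p) Q)
      (hmean : ∀ i, Q[Z i] = 0) (hcov : ∀ i j, cov[Z i, Z j; Q] = V i j) :
      Q.map (fun p i => Z i p) = volume.withDensity fun y => ENNReal.ofReal (gaussianDensity V y) := by
    have := hZ.isGaussian_map
    refine eq_withDensity_gaussianDensity hV (fun i => ?_) fun i j => ?_
    · rw [integral_map hZ.aemeasurable (measurable_pi_apply i).aestronglyMeasurable, hmean]
    · rw [covariance_map_fun (measurable_pi_apply i).aestronglyMeasurable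
        (measurable_pi_apply j).aestronglyMeasurable hZ.aemeasurable, hcov]
  have hlawY := hlaw hMpos hGY hmeanY hcovY
  have hN' : N = volume.withDensity fun y => ENNReal.ofReal (gaussianDensity S y) := by
    rw [← hlaw hSpos hGe hmeane hcove]
    exact hsnd.map_eq.symm
  have hmY : Measurable fun p : EuclideanSpace ℝ (Fin n) × (Fin n → ℝ) => fun i => Y i p := by
    fun_prop
  have hmJ : Measurable fun p : EuclideanSpace ℝ (Fin n) × (Fin n → ℝ) => (fun i => Y i p, p.1) := by
    fun_prop
  have hJ : Q.map (fun p => (fun i => Y i p, p.1)) = ((volume : Measure (Fin n → ℝ)).prod G).withDensity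
      fun p => ENNReal.ofReal (gaussianDensity S (p.1 - (EuclideanSpace.equiv (Fin n) ℝ) p.2)) := by
    have : SFinite ((volume : Measure (Fin n → ℝ)).withDensity
      fun y => ENNReal.ofReal (gaussianDensity S y)) := by rw [← hN']; infer_instance
    have hmS := measurable_gaussianDensity S
    have := map_add_prod_eq_withDensity (G := G) (c := EuclideanSpace.equiv (Fin n) ℝ)
      (by fun_prop) (g := fun y => ENNReal.ofReal (gaussianDensity S y)) (by fun_prop)
    rw [← hN'] at this
    exact this
  -- Same reference measure as for the joint law, so the divergence is an integral of a difference
  -- of two log-densities.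
  have hprod : (Q.map (fun p i => Y i p)).prod (Q.map fun p => p.1) =
      ((volume : Measure (Fin n → ℝ)).prod G).withDensity
        fun p => ENNReal.ofReal (gaussianDensity M p.1) := by
    have hmM := measurable_gaussianDensity M
    have : SFinite ((volume : Measure (Fin n → ℝ)).withDensity
      fun y => ENNReal.ofReal (gaussianDensity M y)) := by rw [← hlawY]; infer_instance
    rw [show Q.map (fun p => p.1) = G from hfst.map_eq, hlawY, prod_withDensity_left (by fun_prop)]
  obtain ⟨hintS, hvalS⟩ := integral_log_gaussianDensity hSpos.det_pos he2 hmeane hcove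
  obtain ⟨hintM, hvalM⟩ := integral_log_gaussianDensity hMpos.det_pos hY2 hmeanY hcovY
  have hmS := measurable_gaussianDensity S
  have hmM := measurable_gaussianDensity M
  have hpull (p : EuclideanSpace ℝ (Fin n) × (Fin n → ℝ)) :
      (fun i => Y i p) - (EuclideanSpace.equiv (Fin n) ℝ) p.1 = fun i => e i p := by
    ext i
    simp [hY, hF, he]
  have := Measure.isProbabilityMeasure_map (μ := Q) hmJ.aemeasurable
  have := Measure.isProbabilityMeasure_map (μ := Q) hmY.aemeasurable
  have := Measure.isProbabilityMeasure_map (μ := Q)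
    (f := fun p => p.1) measurable_fst.aemeasurable
  change InformationTheory.klDiv (Q.map (fun p => (fun i => Y i p, p.1)))
    ((Q.map (fun p i => Y i p)).prod (Q.map fun p => p.1)) = _
  have hmlog : Measurable fun p : (Fin n → ℝ) × EuclideanSpace ℝ (Fin n) =>
      Real.log (gaussianDensity S (p.1 - (EuclideanSpace.equiv (Fin n) ℝ) p.2)) -
        Real.log (gaussianDensity M p.1) := by fun_prop
  rw [klDiv_withDensity_ofReal (by fun_prop) (by fun_prop)
    (fun p => gaussianDensity_pos hSpos.det_pos _) (fun p => gaussianDensity_pos hMpos.det_pos _)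
    hJ hprod, integral_map hmJ.aemeasurable hmlog.aestronglyMeasurable]
  -- The normalizing constants and the expected quadratic forms agree for `S` and `M`; only the two
  -- determinants survive.
  · simp_rw [hpull]
    rw [integral_sub hintS hintM, hvalS, hvalM, hS, det_smul, det_one]
    congr 1
    simp
    ring
  · rw [integrable_map_measure hmlog.aestronglyMeasurable hmJ.aemeasurable]
    refine (hintS.sub hintM).congr (Filter.Eventually.of_forall fun p => ?_)
    simp only [Function.comp_def, hpull]
    rfl

end InfoGain

/-! ### Posterior variances and the information gain -/

section PosteriorVariance

variable {X : Type*} {k : X → X → ℝ} {σ : ℝ}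

lemma kernel_symm (hk : (Matrix.of k).PosSemidef) (z w : X) : k z w = k w z := by
  simpa using (hk.isHermitian.apply z w).symm

lemma postVar_le (hk : (Matrix.of k).PosSemidef) (hσ : 0 < σ) {n : ℕ} (a : Fin n → X) (z : X) :
    postVar k σ a z ≤ k z z := by
  have h := (gram_add_posDef hk hσ a).inv.posSemidef.dotProduct_mulVec_nonneg fun i => k z (a i)
  simp only [star_trivial] at h
  rw [postVar]
  linarith

/-- The last factor is the Schur complement of the leading `t × t` block. -/
lemma det_gram_add_succ (hk : (Matrix.of k).PosSemidef) (hσ : 0 < σ) (a : ℕ → X) (t : ℕ) :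
    (gram k (fun s : Fin (t + 1) => a s) + σ ^ 2 • (1 : Matrix (Fin (t + 1)) (Fin (t + 1)) ℝ)).det =
      (gram k (fun s : Fin t => a s) + σ ^ 2 • (1 : Matrix (Fin t) (Fin t) ℝ)).det *
        (σ ^ 2 + postVar k σ (fun s : Fin t => a s) (a t)) := by
  set M := gram k (fun s : Fin t => a s) + σ ^ 2 • (1 : Matrix (Fin t) (Fin t) ℝ) with hM
  have hMdet : IsUnit M.det := (gram_add_posDef hk hσ _).det_pos.ne'.isUnit
  let _ : Invertible M := M.invertibleOfIsUnitDet hMdet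
  rw [← det_submatrix_equiv_self (finSumFinEquiv (m := t) (n := 1))]
  have hblock : (gram k (fun s : Fin (t + 1) => a s) +
      σ ^ 2 • (1 : Matrix (Fin (t + 1)) (Fin (t + 1)) ℝ)).submatrix finSumFinEquiv finSumFinEquiv =
      fromBlocks M (of fun i _ => k (a t) (a i)) (of fun _ i => k (a t) (a i))
        (of fun (_ _ : Fin 1) => k (a t) (a t) + σ ^ 2) := by
    ext i j
    rcases i with i | i <;> rcases j with j | j
    · simp [gram, hM, one_apply, Fin.ext_iff]
    · have : (i : ℕ) ≠ t := i.2.ne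
      simp [gram, one_apply, Fin.ext_iff, this, kernel_symm hk (a i) (a t)]
    · have : t ≠ (j : ℕ) := j.2.ne'
      simp [gram, one_apply, Fin.ext_iff, this]
    · simp [gram, one_apply, Fin.ext_iff]
  rw [hblock, det_fromBlocks₁₁, det_fin_one, invOf_eq_nonsing_inv]
  congr 1
  rw [postVar, ← hM, dotProduct_mulVec]
  simp only [Matrix.sub_apply, of_apply, mul_apply, vecMul, dotProduct]
  ring

/-- Telescoping of the Schur complements, the chain rule for information. Nonnegativity of the
posterior variance is assumed here; it comes later from its being the variance of a residual. -/
lemma log_det_gram_add (hk : (Matrix.of k).PosSemidef) (hσ : 0 < σ) (a : ℕ → X)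
    (hpos : ∀ t, 0 ≤ postVar k σ (fun s : Fin t => a s) (a t)) (T : ℕ) :
    Real.log (gram k (fun s : Fin T => a s) + σ ^ 2 • (1 : Matrix (Fin T) (Fin T) ℝ)).det
      - T * Real.log (σ ^ 2) =
      ∑ t ∈ Finset.range T,
        Real.log (1 + (σ ^ 2)⁻¹ * postVar k σ (fun s : Fin t => a s) (a t)) := by
  have hs : 0 < σ ^ 2 := by positivity
  induction T with
  | zero => simp
  | succ T ih =>
    have h1 : 0 < σ ^ 2 + postVar k σ (fun s : Fin T => a s) (a T) := by linarith [hpos T]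
    have h2 : 1 + (σ ^ 2)⁻¹ * postVar k σ (fun s : Fin T => a s) (a T) =
        (σ ^ 2 + postVar k σ (fun s : Fin T => a s) (a T)) / σ ^ 2 := by field_simp
    rw [Finset.sum_range_succ, ← ih, det_gram_add_succ hk hσ, h2,
      Real.log_mul (gram_add_posDef hk hσ _).det_pos.ne' h1.ne', Real.log_div h1.ne' hs.ne']
    push_cast
    ring

/-- The graph of `log` lies above its chord from `1` to `1 + c`. The restriction `s ≤ 1` is where
the bound on `k z z` enters. -/
lemma log_one_add_mul_ge {c s : ℝ} (hc : 0 < c) (hs0 : 0 ≤ s) (hs1 : s ≤ 1) :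
    s * Real.log (1 + c) ≤ Real.log (1 + c * s) := by
  have h := strictConcaveOn_log_Ioi.concaveOn.2 (Set.mem_Ioi.2 one_pos)
    (Set.mem_Ioi.2 (by linarith : 0 < 1 + c)) (sub_nonneg.2 hs1) hs0 (by ring)
  simp only [smul_eq_mul, Real.log_one, mul_zero, zero_add] at h
  rwa [show (1 - s) * 1 + s * (1 + c) = 1 + c * s by ring] at h

lemma infoGain_le_maxInfoGain [Finite X] (hk : (Matrix.of k).PosSemidef) (hσ : 0 < σ) {n : ℕ}
    (a : Fin n → X) :
    (Real.log (gram k a + σ ^ 2 • (1 : Matrix (Fin n) (Fin n) ℝ)).det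
        - n * Real.log (σ ^ 2)) / 2 ≤ maxInfoGain k σ n := by
  -- Finiteness is essential: `toReal` would send an infinite supremum to `0`.
  have hfin : (⨆ a : Fin n → X, infoGain k σ a) ≠ ⊤ := by
    exact iSup_ne_top fun a => by rw [infoGain_eq hk hσ]; exact ENNReal.ofReal_ne_top
  refine (ENNReal.ofReal_le_iff_le_toReal hfin).1 ?_
  rw [← infoGain_eq hk hσ]
  exact le_iSup (fun a : Fin n → X => infoGain k σ a) a

lemma sum_postVar_le [Finite X] (hk : (Matrix.of k).PosSemidef) (hk1 : ∀ z, k z z ≤ 1)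
    (hσ : 0 < σ) (a : ℕ → X) (hpos : ∀ t, 0 ≤ postVar k σ (fun s : Fin t => a s) (a t)) (T : ℕ) :
    ∑ t ∈ Finset.range T, postVar k σ (fun s : Fin t => a s) (a t) ≤
      2 / Real.log (1 + (σ ^ 2)⁻¹) * maxInfoGain k σ T := by
  have hc : 0 < (σ ^ 2)⁻¹ := by positivity
  have hlog : 0 < Real.log (1 + (σ ^ 2)⁻¹) := Real.log_pos (by linarith)
  have h1 := infoGain_le_maxInfoGain hk hσ fun s : Fin T => a s
  rw [log_det_gram_add hk hσ a hpos] at h1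
  have h2 : (∑ t ∈ Finset.range T, postVar k σ (fun s : Fin t => a s) (a t)) *
      Real.log (1 + (σ ^ 2)⁻¹) ≤ ∑ t ∈ Finset.range T,
        Real.log (1 + (σ ^ 2)⁻¹ * postVar k σ (fun s : Fin t => a s) (a t)) := by
    rw [Finset.sum_mul]
    exact Finset.sum_le_sum fun t _ => log_one_add_mul_ge hc (hpos t)
      ((postVar_le hk hσ _ _).trans (hk1 _))
  rw [div_mul_eq_mul_div, le_div_iff₀ hlog]
  linarith

end PosteriorVariance

/-! ### Gaussian conditioning and tail bounds -/

section Conditioning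

variable {Ω : Type*} [MeasurableSpace Ω] {P : Measure Ω} {n : ℕ}

/-- The residual of the best linear predictor of a Gaussian variable `g` from a jointly Gaussian
vector `Y` is independent of `Y`, centred and Gaussian. -/
lemma gaussian_residual [IsProbabilityMeasure P] {g : Ω → ℝ} {Y : Fin n → Ω → ℝ}
    (hG : HasGaussianLaw (fun ω => (g ω, fun i => Y i ω)) P) (hg : P[g] = 0)
    (hY : ∀ i, P[Y i] = 0) {M : Matrix (Fin n) (Fin n) ℝ} (hM : IsUnit M.det)
    (hYY : ∀ i j, cov[Y i, Y j; P] = M i j) {b : Fin n → ℝ} (hgY : ∀ i, cov[g, Y i; P] = b i) :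
    IndepFun (fun ω => g ω - b ⬝ᵥ M⁻¹ *ᵥ fun i => Y i ω) (fun ω i => Y i ω) P ∧
      P.map (fun ω => g ω - b ⬝ᵥ M⁻¹ *ᵥ fun i => Y i ω) =
        gaussianReal 0 (cov[g, g; P] - b ⬝ᵥ M⁻¹ *ᵥ b).toNNReal ∧
      0 ≤ cov[g, g; P] - b ⬝ᵥ M⁻¹ *ᵥ b := by
  set w := b ᵥ* M⁻¹ with hw
  have hres (ω : Ω) : g ω - b ⬝ᵥ M⁻¹ *ᵥ (fun i => Y i ω) = g ω - ∑ j, w j * Y j ω := by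
    rw [dotProduct_mulVec]; rfl
  have hwb : b ⬝ᵥ M⁻¹ *ᵥ b = ∑ j, w j * b j := by rw [dotProduct_mulVec]; rfl
  simp_rw [hres, hwb]
  have hg2 : MemLp g 2 P := hG.fst.memLp_two
  have hY2 (i : Fin n) : MemLp (Y i) 2 P :=
    (HasGaussianLaw.eval (E := fun _ : Fin n => ℝ) hG.snd i).memLp_two
  have hwY2 (j : Fin n) : MemLp (fun ω => w j * Y j ω) 2 P := (hY2 j).const_mul _
  have hS2 : MemLp (fun ω => ∑ j, w j * Y j ω) 2 P := memLp_finsetSum _ fun j _ => hwY2 j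
  set D : Ω → ℝ := fun ω => g ω - ∑ j, w j * Y j ω with hD
  have hD2 : MemLp D 2 P := hg2.sub hS2
  have hDcov {Z : Ω → ℝ} (hZ : MemLp Z 2 P) :
      cov[D, Z; P] = cov[g, Z; P] - ∑ j, w j * cov[Y j, Z; P] := by
    rw [hD, covariance_fun_sub_left hg2 hS2 hZ, covariance_fun_sum_left hwY2 hZ]
    simp_rw [covariance_const_mul_left]
  -- The normal equations `w ᵥ* M = b`.
  have hDY (i : Fin n) : cov[D, Y i; P] = 0 := by
    have : ∑ j, w j * M j i = b i := by
      change (w ᵥ* M) i = b i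
      rw [hw, vecMul_vecMul, nonsing_inv_mul _ hM, vecMul_one]
    rw [hDcov (hY2 i), hgY]
    simp_rw [hYY]
    rw [this, sub_self]
  -- As `D` is uncorrelated with every `Y i`, its variance is `cov[D, g]`.
  have hvar : Var[D; P] = cov[g, g; P] - ∑ j, w j * b j := by
    rw [← covariance_self hD2.aemeasurable]
    nth_rw 2 [hD]
    rw [covariance_fun_sub_right hD2 hg2 hS2, covariance_fun_sum_right hwY2 hD2]
    simp_rw [covariance_const_mul_right, hDY, mul_zero, Finset.sum_const_zero, sub_zero]
    rw [hDcov hg2]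
    simp_rw [covariance_comm (Y _) g, hgY]
  -- The residual is viewed as a family over `Unit` to fit the coordinatewise criterion that jointly
  -- Gaussian, uncorrelated families are independent.
  let L : ℝ × (Fin n → ℝ) →L[ℝ] (Unit → ℝ) × (Fin n → ℝ) :=
    (ContinuousLinearMap.pi fun _ => ContinuousLinearMap.fst ℝ ℝ (Fin n → ℝ) -
      (∑ j, w j • ContinuousLinearMap.proj j) ∘L ContinuousLinearMap.snd ℝ ℝ (Fin n → ℝ)).prod
      (ContinuousLinearMap.snd ℝ ℝ (Fin n → ℝ))
  have hDYlaw : HasGaussianLaw (fun ω => ((fun _ : Unit => D ω), fun i => Y i ω)) P := by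
    have hL : (fun ω => ((fun _ : Unit => D ω), fun i => Y i ω)) =
        L ∘ fun ω => (g ω, fun i => Y i ω) := by
      ext ω <;> simp [L, hD]
    rw [hL]
    exact hG.map L
  have hDlaw : HasGaussianLaw D P :=
    HasGaussianLaw.eval (E := fun _ : Unit => ℝ) (X := fun _ => D) hDYlaw.fst ()
  have hDmean : P[D] = 0 := by
    rw [hD, integral_sub (hg2.integrable (by norm_num)) (hS2.integrable (by norm_num)), hg,
      integral_finsetSum _ fun j _ => (hwY2 j).integrable (by norm_num)]
    simp [integral_const_mul, hY]
  refine ⟨?_, ?_, ?_⟩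
  · have := hDYlaw.indepFun_of_covariance_eval (X := fun _ : Unit => D) fun _ i => hDY i
    exact this.comp (φ := fun x : Unit → ℝ => x ()) (ψ := id) (measurable_pi_apply _) measurable_id
  · rw [hDlaw.map_eq_gaussianReal, hDmean, hvar]
  · rw [← hvar]
    exact variance_nonneg _ _

/-- Shift by `c` and use `(x + c)² ≥ x² + c²` for `x, c ≥ 0`. Keeping the half-line mass on the
right is what yields constant one in the two-sided bound. -/
lemma gaussianReal_Ioi_le {v : NNReal} (hv : v ≠ 0) {c : ℝ} (hc : 0 ≤ c) :
    gaussianReal 0 v (Set.Ioi c) ≤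
      ENNReal.ofReal (Real.exp (-c ^ 2 / (2 * v))) * gaussianReal 0 v (Set.Ioi 0) := by
  rw [gaussianReal_apply 0 hv, gaussianReal_apply 0 hv, ← lintegral_indicator measurableSet_Ioi,
    ← lintegral_add_right_eq_self _ c, ← lintegral_const_mul _ (by fun_prop),
    ← lintegral_indicator measurableSet_Ioi]
  refine lintegral_mono fun x => ?_
  by_cases hx : 0 < x
  · have hx' : c < x + c := by linarith
    simp only [Set.indicator, Set.mem_Ioi, hx, hx', if_true, gaussianPDF]
    rw [← ENNReal.ofReal_mul (Real.exp_pos _).le]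
    refine ENNReal.ofReal_le_ofReal ?_
    rw [gaussianPDFReal, gaussianPDFReal, mul_left_comm, ← Real.exp_add]
    have hvp : (0 : ℝ) < v := by positivity
    gcongr
    rw [← add_div]
    gcongr
    nlinarith [mul_nonneg hx.le hc]
  · have hx' : ¬ c < x + c := by linarith
    simp [hx, hx']

/-- The two-sided tail bound for a centred Gaussian law, with constant one. -/
lemma gaussianReal_abs_gt_le (v : NNReal) {c : ℝ} (hc : 0 ≤ c) :
    gaussianReal 0 v {x | c * √v < |x|} ≤ ENNReal.ofReal (Real.exp (-c ^ 2 / 2)) := by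
  -- The degenerate law is the Dirac mass at `0`, where the strict inequality fails.
  by_cases hv : v = 0
  · subst hv
    simp
  set d := c * √v with hd
  have hd0 : 0 ≤ d := by positivity
  have hset : {x : ℝ | d < |x|} = Set.Ioi d ∪ Set.Iio (-d) := by
    ext x
    simp [lt_abs, lt_neg]
  have hneg (r : ℝ) : gaussianReal 0 v (Set.Iio (-r)) = gaussianReal 0 v (Set.Ioi r) := by
    conv_lhs => rw [← neg_zero, ← gaussianReal_map_neg (μ := 0),
      Measure.map_apply (by fun_prop) measurableSet_Iio]
    congr 1
    ext x
    simp
  have hexp : -d ^ 2 / (2 * v) = -c ^ 2 / 2 := by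
    have hvp : (0 : ℝ) < v := by positivity
    rw [hd, mul_pow, Real.sq_sqrt hvp.le]
    field_simp
  have htot : gaussianReal 0 v (Set.Ioi 0) + gaussianReal 0 v (Set.Ioi 0) ≤ 1 := by
    have hdisj : Disjoint (Set.Iio (0 : ℝ)) (Set.Ioi 0) :=
      Set.disjoint_left.2 fun x hx hx' => lt_asymm (Set.mem_Iio.1 hx) (Set.mem_Ioi.1 hx')
    nth_rw 1 [← hneg 0]
    rw [neg_zero, ← measure_union hdisj measurableSet_Ioi]
    exact prob_le_one
  calc gaussianReal 0 v {x | d < |x|}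
      ≤ gaussianReal 0 v (Set.Ioi d) + gaussianReal 0 v (Set.Ioi d) := by
        rw [hset]
        exact (measure_union_le _ _).trans_eq (by rw [hneg])
    _ ≤ ENNReal.ofReal (Real.exp (-c ^ 2 / 2)) *
        (gaussianReal 0 v (Set.Ioi 0) + gaussianReal 0 v (Set.Ioi 0)) := by
        rw [mul_add, ← hexp]
        exact add_le_add (gaussianReal_Ioi_le hv hd0) (gaussianReal_Ioi_le hv hd0)
    _ ≤ ENNReal.ofReal (Real.exp (-c ^ 2 / 2)) := mul_le_of_le_one_right' htot

/-- Both hypotheses together make the joint law a triple product, which can be reassociated. -/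
lemma indepFun_prodMk_of_indepFun [IsProbabilityMeasure P] {α β γ : Type*} [MeasurableSpace α]
    [MeasurableSpace β] [MeasurableSpace γ] {A : Ω → α} {B : Ω → β} {C : Ω → γ}
    (hA : Measurable A) (hB : Measurable B) (hC : Measurable C) (hAB : IndepFun A B P)
    (hABC : IndepFun (fun ω => (A ω, B ω)) C P) : IndepFun A (fun ω => (B ω, C ω)) P := by
  have hBC : IndepFun B C P := hABC.comp (φ := Prod.snd) (ψ := id) measurable_snd measurable_id
  rw [indepFun_iff_map_prod_eq_prod_map_map (by fun_prop) (by fun_prop)] at hAB hABC hBC ⊢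
  have := Measure.isProbabilityMeasure_map (μ := P) hA.aemeasurable
  have := Measure.isProbabilityMeasure_map (μ := P) hB.aemeasurable
  have := Measure.isProbabilityMeasure_map (μ := P) hC.aemeasurable
  rw [hBC, ← Measure.prodAssoc_prod, ← hAB, ← hABC, Measure.map_map (by fun_prop) (by fun_prop)]
  rfl

/-- If the centred Gaussian variable `D` is independent of `V`, then `|D|` exceeds a random multiple
of its standard deviation, determined by `V`, with small probability on any event of `V`. -/
lemma measure_residual_gt_le [IsProbabilityMeasure P] {α : Type*} [MeasurableSpace α] {D : Ω → ℝ}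
    {V : Ω → α} (hD : Measurable D) (hV : Measurable V) (hDV : IndepFun D V P) {v : ℝ}
    (hlaw : P.map D = gaussianReal 0 v.toNNReal) (hv : 0 ≤ v) {u : α → ℝ} (hu : Measurable u)
    (hu01 : ∀ᵐ ω ∂P, u (V ω) ∈ Set.Ioo (0 : ℝ) 1) {B : Set α} (hB : MeasurableSet B) :
    P {ω | √(2 * Real.log (1 / u (V ω))) * √v < |D ω| ∧ V ω ∈ B} ≤
      ∫⁻ ω in V ⁻¹' B, ENNReal.ofReal (u (V ω)) ∂P := by
  rw [indepFun_iff_map_prod_eq_prod_map_map (by fun_prop) (by fun_prop)] at hDV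
  have := Measure.isProbabilityMeasure_map (μ := P) hD.aemeasurable
  have := Measure.isProbabilityMeasure_map (μ := P) hV.aemeasurable
  set s : Set (ℝ × α) := {p | √(2 * Real.log (1 / u p.2)) * √v < |p.1| ∧ p.2 ∈ B} with hs
  have hsm : MeasurableSet s := by
    have h : MeasurableSet {p : ℝ × α | √(2 * Real.log (1 / u p.2)) * √v < |p.1|} :=
      measurableSet_lt (by fun_prop) (by fun_prop)
    exact h.inter (measurable_snd hB)
  have h1 : P {ω | √(2 * Real.log (1 / u (V ω))) * √v < |D ω| ∧ V ω ∈ B} =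
      ((P.map D).prod (P.map V)) s := by
    rw [← hDV, Measure.map_apply (by fun_prop) hsm]
    rfl
  -- Integrating over `D` first, with `V` fixed, makes the threshold a constant.
  rw [h1, Measure.prod_apply_symm hsm, lintegral_map (measurable_measure_prodMk_right hsm) hV,
    ← lintegral_indicator (hV hB)]
  refine lintegral_mono_ae ?_
  filter_upwards [hu01] with ω hω
  by_cases hωB : V ω ∈ B
  · have hlog : 0 ≤ 2 * Real.log (1 / u (V ω)) := by
      have := Real.log_nonneg (one_le_one_div hω.1 hω.2.le)
      linarith
    have h2 := gaussianReal_abs_gt_le v.toNNReal (Real.sqrt_nonneg (2 * Real.log (1 / u (V ω))))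
    rw [Real.sq_sqrt hlog, Real.coe_toNNReal _ hv, one_div, Real.log_inv,
      show -(2 * -Real.log (u (V ω))) / 2 = Real.log (u (V ω)) by ring, Real.exp_log hω.1] at h2
    simpa [hs, hωB, hlaw] using h2
  · simp [hs, hωB]

end Conditioning

/-! ### Optimism and the confidence budget -/

section Regret

/-- Optimism: the maximum of `F` is below the largest upper bound, attained at `y`, and `F y` is at
most one interval width below that bound. -/
lemma iSup_sub_le_of_ucb {X : Type*} [Nonempty X] {F m s : X → ℝ} {β : ℝ} {y : X}
    (hconf : ∀ z, |F z - m z| ≤ β * s z) (hmax : ∀ z, m z + β * s z ≤ m y + β * s y) :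
    (⨆ z, F z) - F y ≤ 2 * (β * s y) := by
  have h : (⨆ z, F z) ≤ m y + β * s y := ciSup_le fun z => by
    linarith [(abs_le.1 (hconf z)).2, hmax z]
  linarith [(abs_le.1 (hconf y)).1]

lemma tsum_confidence_budget {δ c : ℝ} (hδ : 0 ≤ δ) (hc : 0 < c) :
    ∑' t : ℕ, ENNReal.ofReal c *
      ENNReal.ofReal (6 * δ / (c * ((t : ℝ) + 1) ^ 2 * Real.pi ^ 2)) = ENNReal.ofReal δ := by
  have hpi := Real.pi_pos
  have h0 : HasSum (fun t : ℕ => 1 / ((t : ℝ) + 1) ^ 2) (Real.pi ^ 2 / 6) := by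
    -- The dropped term at index `0` is `1 / 0 ^ 2 = 0`.
    have := (hasSum_nat_add_iff' 1).2 hasSum_zeta_two
    simpa using this
  have h1 : HasSum (fun t : ℕ => c * (6 * δ / (c * ((t : ℝ) + 1) ^ 2 * Real.pi ^ 2))) δ := by
    have h2 := h0.mul_left (6 * δ / Real.pi ^ 2)
    rw [show 6 * δ / Real.pi ^ 2 * (Real.pi ^ 2 / 6) = δ by field_simp] at h2
    have h3 (t : ℕ) : c * (6 * δ / (c * ((t : ℝ) + 1) ^ 2 * Real.pi ^ 2)) =
        6 * δ / Real.pi ^ 2 * (1 / ((t : ℝ) + 1) ^ 2) := by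
      field_simp
    simpa only [h3] using h2
  simp_rw [← ENNReal.ofReal_mul hc.le]
  rw [← ENNReal.ofReal_tsum_of_nonneg (fun t => by positivity) h1.summable, h1.tsum_eq]

end Regret

/-! ### Adaptive inputs reduced to fixed paths -/

section Algorithm

variable {Ω X S : Type*} [MeasurableSpace S] {k : X → X → ℝ} {σ : ℝ} {f : X → Ω → ℝ} {ε ζ U : ℕ → Ω → ℝ} {W : Ω → S} {x : ℕ → Ω → X}

lemma history_le_comap (t : ℕ) : history f ε ζ W x t ≤ MeasurableSpace.comap
    (fun ω => ((fun s : Fin t => obs f ε x s ω), ((fun s : Fin (t + 1) => ζ s ω), W ω)))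
    inferInstance := by
  set H : Ω → (Fin t → ℝ) × ((Fin (t + 1) → ℝ) × S) :=
    fun ω => ((fun s : Fin t => obs f ε x s ω), ((fun s : Fin (t + 1) => ζ s ω), W ω))
  have hH : Measurable[MeasurableSpace.comap H inferInstance] H := comap_measurable H
  refine sup_le (sup_le (iSup_le fun s => ?_) (iSup_le fun s => ?_)) ?_
  · exact Measurable.comap_le ((measurable_pi_apply s).comp (measurable_fst.comp hH))
  · exact Measurable.comap_le
      ((measurable_pi_apply s).comp (measurable_fst.comp (measurable_snd.comp hH)))
  · exact Measurable.comap_le (measurable_snd.comp (measurable_snd.comp hH))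

/-- The observations at the fixed inputs `a s`, `s < t`, with the randomness of the algorithm. -/
def fixedData (f : X → Ω → ℝ) (ε U : ℕ → Ω → ℝ) (W : Ω → S) (a : ℕ → X) (t : ℕ) (ω : Ω) :
    (Fin t → ℝ) × ((ℕ → ℝ) × S) :=
  ((fun s => f (a s) ω + ε s ω), ((fun s => U s ω), W ω))

/-- That the first `t` inputs of the algorithm are `a 0, …, a (t - 1)` is determined by the
observations at these fixed inputs and by the randomness of the algorithm. -/
lemma measurableSet_path (hx : ∀ t z, MeasurableSet[history f ε ζ W x t] {ω | x t ω = z})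
    (hζ : ∀ t ω, ζ t ω = 2 * Real.log (1 / U t ω)) (a : ℕ → X) (t : ℕ) :
    MeasurableSet[MeasurableSpace.comap (fixedData f ε U W a t) inferInstance]
      {ω | ∀ s < t, x s ω = a s} := by
  induction t with
  | zero => simp
  | succ t ih =>
    obtain ⟨C, hC, hCx⟩ := history_le_comap t _ (hx t (a t))
    -- `r` forgets the newest observation, which the choice at round `t` may not use; `q` turns the
    -- `U s` into the `ζ s`, `s ≤ t`.
    let r : (Fin (t + 1) → ℝ) × ((ℕ → ℝ) × S) → (Fin t → ℝ) × ((ℕ → ℝ) × S) :=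
      fun p => ((fun s => p.1 s.castSucc), p.2)
    let q : (Fin t → ℝ) × ((ℕ → ℝ) × S) → (Fin t → ℝ) × ((Fin (t + 1) → ℝ) × S) :=
      fun p => (p.1, ((fun s => 2 * Real.log (1 / p.2.1 s)), p.2.2))
    have hr : Measurable r := by fun_prop
    have hq : Measurable q := by
      refine Measurable.prodMk measurable_fst (Measurable.prodMk ?_ (by fun_prop))
      refine measurable_pi_lambda _ fun s => ?_
      have : Measurable fun p : (Fin t → ℝ) × ((ℕ → ℝ) × S) => p.2.1 s :=
        (measurable_pi_apply _).comp (measurable_fst.comp measurable_snd)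
      fun_prop
    have hV : Measurable[MeasurableSpace.comap (fixedData f ε U W a (t + 1)) inferInstance]
        (fixedData f ε U W a (t + 1)) := comap_measurable _
    have hset : {ω | ∀ s < t + 1, x s ω = a s} = {ω | ∀ s < t, x s ω = a s} ∩
        fixedData f ε U W a (t + 1) ⁻¹' ((q ∘ r) ⁻¹' C) := by
      ext ω
      -- Only along the path do the actual observations coincide with those at the fixed inputs,
      -- hence the induction.
      have hstep (h : ∀ s < t, x s ω = a s) :
          x t ω = a t ↔ fixedData f ε U W a (t + 1) ω ∈ (q ∘ r) ⁻¹' C := by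
        have h1 : x t ω = a t ↔ ω ∈ {ω | x t ω = a t} := Iff.rfl
        rw [h1, ← hCx, Set.mem_preimage, Set.mem_preimage]
        have : ∀ s : Fin t, obs f ε x s ω = f (a s) ω + ε s ω := fun s => by
          rw [obs, h s s.2]
        simp [q, r, fixedData, this, hζ]
      constructor
      · intro h
        have h' : ∀ s < t, x s ω = a s := fun s hs => h s (by omega)
        exact ⟨h', (hstep h').1 (h t (by omega))⟩
      · rintro ⟨h, h'⟩ s hs
        rcases Nat.lt_succ_iff_lt_or_eq.1 hs with hs | rfl
        · exact h s hs
        · exact (hstep h).2 h'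
    rw [hset]
    refine MeasurableSet.inter ?_ (hV ((hq.comp hr) hC))
    obtain ⟨B, hB, hBx⟩ := ih
    exact ⟨r ⁻¹' B, hr hB, by rw [← hBx]; rfl⟩

variable [MeasurableSpace Ω] {P : Measure Ω}

lemma hasGaussianLaw_signal [Fintype X] (hf : IsCentredGP P k f) :
    HasGaussianLaw (fun ω z => f z ω) P := by
  let L : (↥(Finset.univ : Finset X) → ℝ) →L[ℝ] (X → ℝ) :=
    ContinuousLinearMap.pi fun z => ContinuousLinearMap.proj ⟨z, Finset.mem_univ z⟩
  exact (hf.gaussian.hasGaussianLaw Finset.univ).map L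

/-- At fixed inputs, the error of the posterior mean is independent of the data and is Gaussian
with the posterior variance. -/
lemma posterior_residual [Fintype X] [IsProbabilityMeasure P] (hk : (Matrix.of k).PosSemidef)
    (hσ : 0 < σ) (hf : IsCentredGP P k f)
    (hε_law : ∀ t, HasLaw (ε t) (gaussianReal 0 (Real.toNNReal (σ ^ 2))) P)
    (hε_indep : iIndepFun ε P) (hfε : IndepFun (fun ω z => f z ω) (fun ω t => ε t ω) P)
    (a : ℕ → X) (t : ℕ) (z : X) :
    IndepFun (fun ω => f z ω - postMean k σ (fun s : Fin t => a s)
        (fun s : Fin t => f (a s) ω + ε s ω) z) (fun ω (s : Fin t) => f (a s) ω + ε s ω) P ∧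
      P.map (fun ω => f z ω - postMean k σ (fun s : Fin t => a s)
        (fun s : Fin t => f (a s) ω + ε s ω) z) =
        gaussianReal 0 (postVar k σ (fun s : Fin t => a s) z).toNNReal ∧
      0 ≤ postVar k σ (fun s : Fin t => a s) z := by
  have hfG := hasGaussianLaw_signal hf
  have hεt : iIndepFun (fun s : Fin t => ε s) P := hε_indep.precomp Fin.val_injective
  have hεG : HasGaussianLaw (fun ω (s : Fin t) => ε s ω) P :=
    hεt.hasGaussianLaw fun s => (hε_law s).hasGaussianLaw
  have hfεt : IndepFun (fun ω z => f z ω) (fun ω (s : Fin t) => ε s ω) P :=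
    hfε.comp (φ := id) (ψ := fun (e : ℕ → ℝ) (s : Fin t) => e s) measurable_id (by fun_prop)
  have hfε1 (w : X) (s : Fin t) : IndepFun (f w) (ε s) P :=
    hfεt.comp (φ := fun g : X → ℝ => g w) (ψ := fun e : Fin t → ℝ => e s) (measurable_pi_apply w)
      (measurable_pi_apply s)
  have hf2 (w : X) : MemLp (f w) 2 P := (hf.gaussian.hasGaussianLaw_eval w).memLp_two
  have hε2 (s : Fin t) : MemLp (ε s) 2 P := (hε_law s).hasGaussianLaw.memLp_two
  have hεmean (s : Fin t) : P[ε s] = 0 := by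
    rw [(hε_law s).integral_eq, integral_id_gaussianReal]
  have hεvar (s : Fin t) : Var[ε s; P] = σ ^ 2 := by
    rw [(hε_law s).variance_eq, variance_id_gaussianReal, Real.coe_toNNReal _ (by positivity)]
  let L : (X → ℝ) × (Fin t → ℝ) →L[ℝ] ℝ × (Fin t → ℝ) :=
    (ContinuousLinearMap.proj z ∘L ContinuousLinearMap.fst ℝ (X → ℝ) (Fin t → ℝ)).prod
      (ContinuousLinearMap.pi fun s =>
        ContinuousLinearMap.proj (a s) ∘L ContinuousLinearMap.fst ℝ (X → ℝ) (Fin t → ℝ) +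
        ContinuousLinearMap.proj s ∘L ContinuousLinearMap.snd ℝ (X → ℝ) (Fin t → ℝ))
  have hG : HasGaussianLaw (fun ω => (f z ω, fun s : Fin t => f (a s) ω + ε s ω)) P :=
    (hfεt.hasGaussianLaw hfG hεG).map L
  have hY (s : Fin t) : ∫ ω, f (a s) ω + ε s ω ∂P = 0 := by
    rw [integral_add ((hf2 _).integrable (by norm_num)) ((hε2 _).integrable (by norm_num)),
      hf.mean_zero, hεmean, add_zero]
  have hYY (i j : Fin t) :
      cov[fun ω => f (a i) ω + ε i ω, fun ω => f (a j) ω + ε j ω; P] =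
        (gram k (fun s : Fin t => a s) + σ ^ 2 • (1 : Matrix (Fin t) (Fin t) ℝ)) i j := by
    rw [covariance_signal_add_noise (F := fun s : Fin t => f (a s)) (e := fun s : Fin t => ε s)
      (fun _ => hf2 _) hε2 (fun _ _ => hfε1 _ _) hεt hεvar, hf.covariance]
    rfl
  have hgY (i : Fin t) : cov[f z, fun ω => f (a i) ω + ε i ω; P] = k z (a i) := by
    change cov[f z, f (a i) + ε i; P] = _
    rw [covariance_add_right (hf2 _) (hf2 _) (hε2 _), hf.covariance,
      (hfε1 z i).covariance_eq_zero (hf2 _) (hε2 _), add_zero]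
  have := gaussian_residual hG (hf.mean_zero z) hY
    (gram_add_posDef hk hσ fun s : Fin t => a s).det_pos.ne'.isUnit hYY hgY
  rwa [hf.covariance] at this

lemma measurable_postMean {n : ℕ} (a : Fin n → X) (z : X) :
    Measurable fun y : Fin n → ℝ => postMean k σ a y z := by
  unfold postMean
  have : Continuous fun y : Fin n → ℝ => (fun i => k z (a i)) ⬝ᵥ
    (Matrix.mulVec (gram k a + σ ^ 2 • (1 : Matrix (Fin n) (Fin n) ℝ))⁻¹ y) := by fun_prop
  exact this.measurable

/-- The confidence interval of round `t` fails at `z` with probability at most `E[U_t]`. -/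
lemma measure_confidence_fail_le [Fintype X] [Nonempty X] [IsProbabilityMeasure P]
    (hk : (Matrix.of k).PosSemidef) (hσ : 0 < σ) (hf : IsCentredGP P k f)
    (hε_meas : ∀ t, Measurable (ε t))
    (hε_law : ∀ t, HasLaw (ε t) (gaussianReal 0 (Real.toNNReal (σ ^ 2))) P)
    (hε_indep : iIndepFun ε P) (hU_meas : ∀ t, Measurable (U t))
    (hU_range : ∀ t, ∀ᵐ ω ∂P, U t ω ∈ Set.Ioo (0 : ℝ) 1)
    (hζ : ∀ t ω, ζ t ω = 2 * Real.log (1 / U t ω)) (hW_meas : Measurable W)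
    (hfε : IndepFun (fun ω z => f z ω) (fun ω t => ε t ω) P)
    (h_env_alg : IndepFun (fun ω => ((fun z => f z ω), (fun t => ε t ω)))
      (fun ω => ((fun t => U t ω), W ω)) P)
    (hx : ∀ t z, MeasurableSet[history f ε ζ W x t] {ω | x t ω = z}) (t : ℕ) (z : X) :
    P {ω | √(ζ t ω) * √(postVar k σ (fun s : Fin t => x s ω) z) <
        |f z ω - postMean k σ (fun s : Fin t => x s ω) (fun s : Fin t => obs f ε x s ω) z|} ≤
      ENNReal.ofReal (∫ ω, U t ω ∂P) := by
  classical
  have hfm := hf.measurable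
  -- Paths of length `t` form a finite index set; the values of the extension beyond `t` play no
  -- role.
  let ext : (Fin t → X) → ℕ → X := fun a s => if h : s < t then a ⟨s, h⟩ else Classical.arbitrary X
  have hext (a : Fin t → X) : (fun s : Fin t => ext a s) = a := by
    ext s
    simp [ext]
  let A : (Fin t → X) → Set Ω := fun a => {ω | ∀ s < t, x s ω = ext a s}
  have hV (a : Fin t → X) : Measurable (fixedData f ε U W (ext a) t) := by
    unfold fixedData
    fun_prop
  have hAx {a : Fin t → X} {ω : Ω} (h : ω ∈ A a) : (fun s : Fin t => x s ω) = a := by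
    rw [← hext a]
    exact funext fun s => h s s.2
  have hxA (ω : Ω) : ω ∈ A fun s : Fin t => x s ω := fun s hs => by simp [ext, hs]
  have hAm (a : Fin t → X) : MeasurableSet (A a) :=
    (hV a).comap_le _ (measurableSet_path hx hζ (ext a) t)
  have hbound (a : Fin t → X) :
      P {ω | √(ζ t ω) * √(postVar k σ (fun s : Fin t => x s ω) z) <
        |f z ω - postMean k σ (fun s : Fin t => x s ω) (fun s : Fin t => obs f ε x s ω) z| ∧
          ω ∈ A a} ≤ ∫⁻ ω in A a, ENNReal.ofReal (U t ω) ∂P := by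
    obtain ⟨B, hB, hBA⟩ := measurableSet_path hx hζ (ext a) t
    obtain ⟨hind, hlaw, hpos⟩ := posterior_residual hk hσ hf hε_law hε_indep hfε (ext a) t z
    set D : Ω → ℝ := fun ω => f z ω - postMean k σ (fun s : Fin t => ext a s)
      (fun s : Fin t => f (ext a s) ω + ε s ω) z
    have hpm := measurable_postMean (k := k) (σ := σ) (fun s : Fin t => ext a s) z
    have hDm : Measurable D := by fun_prop
    -- Independence from the observations is Gaussian; independence of the residual and observations
    -- from `(U, W)` is inherited from `h_env_alg`.
    have hDV : IndepFun D (fixedData f ε U W (ext a) t) P := by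
      refine indepFun_prodMk_of_indepFun hDm (by fun_prop) (by fun_prop) hind ?_
      refine h_env_alg.comp (φ := fun p : (X → ℝ) × (ℕ → ℝ) =>
        (p.1 z - postMean k σ (fun s : Fin t => ext a s)
          (fun s : Fin t => p.1 (ext a s) + p.2 s) z, fun s : Fin t => p.1 (ext a s) + p.2 s))
        (ψ := id) ?_ measurable_id
      have h1 (w : X) : Measurable fun p : (X → ℝ) × (ℕ → ℝ) => p.1 w :=
        (measurable_pi_apply w).comp measurable_fst
      have h2 : Measurable fun (p : (X → ℝ) × (ℕ → ℝ)) (s : Fin t) => p.1 (ext a s) + p.2 s :=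
        measurable_pi_lambda _ fun s =>
          (h1 _).add ((measurable_pi_apply (s : ℕ)).comp measurable_snd)
      exact ((h1 z).sub (hpm.comp h2)).prodMk h2
    have hu : Measurable fun p : (Fin t → ℝ) × ((ℕ → ℝ) × S) => p.2.1 t :=
      (measurable_pi_apply t).comp (measurable_fst.comp measurable_snd)
    have h := measure_residual_gt_le hDm (hV a) hDV hlaw hpos hu (hU_range t) hB
    rw [hBA] at h
    refine (measure_mono fun ω hω => ?_).trans h
    obtain ⟨hω1, hωA⟩ := hω
    have hobs : (fun s : Fin t => obs f ε x s ω) = fun s : Fin t => f (ext a s) ω + ε s ω :=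
      funext fun s => by rw [obs, hωA s s.2]
    have hxs : (fun s : Fin t => x s ω) = fun s : Fin t => ext a s := funext fun s => hωA s s.2
    refine ⟨?_, ?_⟩
    · rw [hobs, hxs, hζ] at hω1
      exact hω1
    · have : ω ∈ fixedData f ε U W (ext a) t ⁻¹' B := by rw [hBA]; exact hωA
      exact this
  have hdisj : Pairwise (Function.onFun Disjoint A) := fun a b hab =>
    Set.disjoint_left.2 fun ω ha hb => hab ((hAx ha).symm.trans (hAx hb))
  have hUint : Integrable (U t) P := by
    refine Integrable.of_bound (hU_meas t).aestronglyMeasurable 1 ?_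
    filter_upwards [hU_range t] with ω hω
    rw [Real.norm_of_nonneg hω.1.le]
    exact hω.2.le
  calc _ ≤ P (⋃ a, {ω | √(ζ t ω) * √(postVar k σ (fun s : Fin t => x s ω) z) <
        |f z ω - postMean k σ (fun s : Fin t => x s ω) (fun s : Fin t => obs f ε x s ω) z| ∧
          ω ∈ A a}) := measure_mono fun ω hω => Set.mem_iUnion.2 ⟨fun s => x s ω, hω, hxA ω⟩
    _ ≤ ∑' a, ∫⁻ ω in A a, ENNReal.ofReal (U t ω) ∂P :=
        (measure_iUnion_le _).trans (ENNReal.tsum_le_tsum hbound)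
    -- Disjointness of the path events is what avoids a factor counting the paths.
    _ = ∫⁻ ω in ⋃ a, A a, ENNReal.ofReal (U t ω) ∂P := (lintegral_iUnion hAm hdisj _).symm
    _ ≤ ∫⁻ ω, ENNReal.ofReal (U t ω) ∂P := setLIntegral_le_lintegral _ _
    _ = ENNReal.ofReal (∫ ω, U t ω ∂P) :=
        (ofReal_integral_eq_lintegral_ofReal hUint
          ((hU_range t).mono fun ω hω => hω.1.le)).symm

end Algorithm

end GPUCB

end

/-! ### The regret bound -/

theorem mainTheorem7 {Ω X S : Type*} [MeasurableSpace Ω] [MeasurableSpace S] [Fintype X]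
    (P : Measure Ω) [IsProbabilityMeasure P]
    (k : X → X → ℝ) (hk : (Matrix.of k).PosSemidef) (hk1 : ∀ z, k z z ≤ 1)
    (σ : ℝ) (hσ : 0 < σ) (δ : ℝ) (hδ : δ ∈ Set.Ioo (0 : ℝ) 1)
    (f : X → Ω → ℝ) (hf : GPUCB.IsCentredGP P k f)
    (ε : ℕ → Ω → ℝ) (hε_meas : ∀ t, Measurable (ε t))
    (hε_law : ∀ t, HasLaw (ε t) (gaussianReal 0 (Real.toNNReal (σ ^ 2))) P)
    (hε_indep : iIndepFun ε P)
    (U : ℕ → Ω → ℝ) (hU_meas : ∀ t, Measurable (U t)) (hU_indep : iIndepFun U P)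
    (hU_range : ∀ t, ∀ᵐ ω ∂P, U t ω ∈ Set.Ioo (0 : ℝ) 1)
    (hU_mean : ∀ t : ℕ,
      ∫ ω, U t ω ∂P = 6 * δ / ((Fintype.card X : ℝ) * ((t : ℝ) + 1) ^ 2 * Real.pi ^ 2))
    (ζ : ℕ → Ω → ℝ) (hζ : ∀ t ω, ζ t ω = 2 * Real.log (1 / U t ω))
    (W : Ω → S) (hW_meas : Measurable W)
    (h_f_noise : IndepFun (fun ω z => f z ω) (fun ω t => ε t ω) P)
    (h_env_alg : IndepFun (fun ω => ((fun z => f z ω), (fun t => ε t ω)))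
      (fun ω => ((fun t => U t ω), W ω)) P)
    (x : ℕ → Ω → X) (hx : GPUCB.IsRandomizedGPUCB P k σ f ε ζ W x) :
    ENNReal.ofReal (1 - δ) ≤
      P {ω | ∀ T : ℕ, 1 ≤ T →
        GPUCB.cumRegret f x T ω ≤
          2 * √(2 / Real.log (1 + (σ ^ 2)⁻¹) * GPUCB.maxInfoGain k σ T *
            ∑ t ∈ Finset.range T, ζ t ω)} := by
  obtain ⟨ω₀⟩ : Nonempty Ω := nonempty_of_isProbabilityMeasure P
  have : Nonempty X := ⟨x 0 ω₀⟩
  have hcard : (0 : ℝ) < Fintype.card X := by exact_mod_cast Fintype.card_pos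
  set good := {ω | ∀ T : ℕ, 1 ≤ T → GPUCB.cumRegret f x T ω ≤
    2 * √(2 / Real.log (1 + (σ ^ 2)⁻¹) * GPUCB.maxInfoGain k σ T *
      ∑ t ∈ Finset.range T, ζ t ω)}
  set bad : ℕ → X → Set Ω := fun t z =>
    {ω | √(ζ t ω) * √(GPUCB.postVar k σ (fun s : Fin t => x s ω) z) <
      |f z ω - GPUCB.postMean k σ (fun s : Fin t => x s ω)
        (fun s : Fin t => GPUCB.obs f ε x s ω) z|}
  have hbad_le : P (⋃ t, ⋃ z, bad t z) ≤ ENNReal.ofReal δ := by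
    rw [← GPUCB.tsum_confidence_budget hδ.1.le hcard]
    refine (measure_iUnion_le _).trans (ENNReal.tsum_le_tsum fun t => ?_)
    refine (measure_iUnion_le _).trans ?_
    rw [tsum_fintype]
    refine (Finset.sum_le_card_nsmul _ _ _ fun z _ => GPUCB.measure_confidence_fail_le hk hσ hf
      hε_meas hε_law hε_indep hU_meas hU_range hζ hW_meas h_f_noise h_env_alg hx.nonanticipating
      t z).trans_eq ?_
    rw [hU_mean, nsmul_eq_mul, ENNReal.ofReal_natCast, Finset.card_univ]
  have hcompl : P goodᶜ ≤ ENNReal.ofReal δ := by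
    -- Up to a null set, a failure of the regret bound forces a failed confidence interval.
    refine le_trans (measure_mono_ae ?_) hbad_le
    filter_upwards [hx.maximizes, ae_all_iff.2 hU_range] with ω hmax hU hω
    by_contra hnot
    refine hω fun T _ => ?_
    have hconf (t : ℕ) (z : X) : |f z ω - GPUCB.postMean k σ (fun s : Fin t => x s ω)
        (fun s : Fin t => GPUCB.obs f ε x s ω) z| ≤
        √(ζ t ω) * √(GPUCB.postVar k σ (fun s : Fin t => x s ω) z) :=
      not_lt.1 fun h => hnot (Set.mem_iUnion.2 ⟨t, Set.mem_iUnion.2 ⟨z, h⟩⟩)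
    have hζ0 (t : ℕ) : 0 ≤ ζ t ω := by
      rw [hζ]
      have := Real.log_nonneg (one_le_one_div (hU t).1 (hU t).2.le)
      linarith
    -- Posterior variances do not involve the observations, so the realized path of this `ω` may be
    -- treated as a fixed one.
    have hv0 (t : ℕ) : 0 ≤ GPUCB.postVar k σ (fun s : Fin t => x s ω) (x t ω) :=
      (GPUCB.posterior_residual hk hσ hf hε_law hε_indep h_f_noise (fun s => x s ω) t
        (x t ω)).2.2
    have hζs : 0 ≤ ∑ t ∈ Finset.range T, ζ t ω := Finset.sum_nonneg fun t _ => hζ0 t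
    calc GPUCB.cumRegret f x T ω
        ≤ ∑ t ∈ Finset.range T,
          2 * (√(ζ t ω) * √(GPUCB.postVar k σ (fun s : Fin t => x s ω) (x t ω))) :=
          Finset.sum_le_sum fun t _ =>
            GPUCB.iSup_sub_le_of_ucb (F := fun z => f z ω) (hconf t) (hmax t)
      _ ≤ 2 * (√(∑ t ∈ Finset.range T, ζ t ω) *
          √(∑ t ∈ Finset.range T, GPUCB.postVar k σ (fun s : Fin t => x s ω) (x t ω))) := by
          rw [← Finset.mul_sum]
          gcongr
          exact Real.sum_sqrt_mul_sqrt_le _ hζ0 hv0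
      _ ≤ _ := by
          rw [← Real.sqrt_mul hζs, mul_comm (∑ t ∈ Finset.range T, ζ t ω)]
          gcongr
          exact GPUCB.sum_postVar_le hk hk1 hσ (fun s => x s ω) hv0 T
  -- Subadditivity suffices, so measurability of `good` is never needed.
  have huniv : 1 ≤ P good + P goodᶜ := by
    rw [← measure_univ (μ := P), ← Set.union_compl_self good]
    exact measure_union_le _ _
  rw [ENNReal.ofReal_sub _ hδ.1.le, ENNReal.ofReal_one, tsub_le_iff_right]
  exact huniv.trans (by gcongr)
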